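/- Let $\ell, n \ge 1$ be integers, let $\mathbb{H} = \{x \in \mathbb{R}^n : x_1 + \dots + x_n = 0\}$, and let $a = (a_{i,j})$ be a real $\ell \times (n-1)$ matrix. For $i \in [\ell]$ and $1 \le s \le t \le n$ put $A_{i,s,t} = \sum_{s \le j < t} a_{i,j}$ and $A_{i,t,s} = -A_{i,s,t}$. Assume that $a$ is generic: for all $k \ge 1$, all $i_1, \dots, i_k \in [\ell]$ and all pairwise distinct $r_1, \dots, r_k \in [n]$, with the convention $r_0 = r_k$, the equality $\sum_{j=1}^{k} A_{i_j, r_{j-1}, r_j} = 0$ implies $i_1 = \dots = i_k$. The $(\ell,n)$-braid arrangement $\mathcal{B}_n^\ell$ (the union of $\ell$ generically translated copies of the braid arrangement) is the arrangement in $\mathbb{H}$ of the hyperplanes $\{x \in \mathbb{H} : x_s - x_t = A_{i,s,t}\}$ for $1 \le s < t \le n$ and $i \in [\ell]$. Its flats are the non-empty intersections of some of its hyperplanes (the empty intersection being $\mathbb{H}$), ordered by reverse inclusion; with $\mu$ the Möbius function of this poset, the characteristic polynomial of $\mathcal{B}_n^\ell$ is $\chi(y) = \sum_{F} \mu(\mathbb{H},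 F)\, y^{\dim F}$, where $F$ ranges over all flats. Then, for every such generic $a$, \[ \chi(y) = \frac{(-1)^n\, n!}{y} \, [z^n] \, \exp\Bigl( - \sum_{m \ge 1} \frac{F_{\ell,m}\, y\, z^m}{m} \Bigr), \qquad \text{where } F_{\ell,m} = \frac{1}{(\ell-1)m+1} \binom{\ell m}{m} \] is the Fuss--Catalan number, and $[z^n]$ denotes the coefficient of $z^n$ in a power series in $z$ with coefficients in $\mathbb{Q}[y]$. -/

import Mathlib

open scoped Nat

/-- A finite affine real hyperplane arrangement in the real vector space `V`. -/
structure HyperplaneArrangement (V : Type*) [AddCommGroup V] [Module ℝ V] where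
  carrier : Set (AffineSubspace ℝ V)
  finite : carrier.Finite
  isHyperplane : ∀ H ∈ carrier, (H : Set V).Nonempty ∧ IsCoatom H.direction

namespace HyperplaneArrangement

/-- A flat is a nonempty intersection of some hyperplanes of the arrangement
(the empty intersection being the whole space). -/
def IsFlat {V : Type*} [AddCommGroup V] [Module ℝ V] (𝒜 : HyperplaneArrangement V)
    (F : AffineSubspace ℝ V) : Prop :=
  (F : Set V).Nonempty ∧ ∃ S ⊆ 𝒜.carrier, F = sInf S

/-- The flat poset: all flats, ordered by reverse inclusion. -/
abbrev FlatPoset {V : Type*} [AddCommGroup V] [Module ℝ V] (𝒜 : HyperplaneArrangement V) :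
    Type _ :=
  {F : (AffineSubspace ℝ V)ᵒᵈ // 𝒜.IsFlat (OrderDual.ofDual F)}

instance finite_flatPoset {V : Type*} [AddCommGroup V] [Module ℝ V]
    (𝒜 : HyperplaneArrangement V) : Finite 𝒜.FlatPoset := by
  have h : {F : AffineSubspace ℝ V | 𝒜.IsFlat F}.Finite := by
    refine (𝒜.finite.finite_subsets.image sInf).subset ?_
    rintro F ⟨-, S, hS, rfl⟩
    exact ⟨S, hS, rfl⟩
  exact h.to_subtype

noncomputable instance fintypeFlatPoset {V : Type*} [AddCommGroup V] [Module ℝ V]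
    (𝒜 : HyperplaneArrangement V) : Fintype 𝒜.FlatPoset :=
  Fintype.ofFinite _

open Classical in
noncomputable instance locallyFiniteOrderFlatPoset {V : Type*} [AddCommGroup V] [Module ℝ V]
    (𝒜 : HyperplaneArrangement V) : LocallyFiniteOrder 𝒜.FlatPoset :=
  Fintype.toLocallyFiniteOrder

/-- The ambient space, as the minimal element of the flat poset. -/
def ambientFlat {V : Type*} [AddCommGroup V] [Module ℝ V] (𝒜 : HyperplaneArrangement V) :
    𝒜.FlatPoset :=
  ⟨OrderDual.toDual ⊤, ⟨0, AffineSubspace.mem_top ℝ V 0⟩, ∅, Set.empty_subset _, sInf_empty.symm⟩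

/-- The dimension of a flat. -/
noncomputable def flatDim {V : Type*} [AddCommGroup V] [Module ℝ V]
    {𝒜 : HyperplaneArrangement V} (F : 𝒜.FlatPoset) : ℕ :=
  Module.finrank ℝ (OrderDual.ofDual F.1).direction

open Classical in
/-- The characteristic polynomial `∑ F, μ(V, F) y ^ dim F`, where `F` ranges over the flats and
`μ` is the Möbius function of the flat poset. -/
noncomputable def charPoly {V : Type*} [AddCommGroup V] [Module ℝ V]
    (𝒜 : HyperplaneArrangement V) : Polynomial ℤ :=
  ∑ F : 𝒜.FlatPoset,
    Polynomial.C (IncidenceAlgebra.mu ℤ 𝒜.ambientFlat F) * Polynomial.X ^ flatDim F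

end HyperplaneArrangement

namespace MultiBraid

/-- The linear hyperplane `∑ x_s = 0` of `ℝⁿ`. -/
def sumZero (n : ℕ) : Submodule ℝ (Fin n → ℝ) where
  carrier := {x | ∑ s, x s = 0}
  add_mem' {x y} hx hy := by
    simp only [Set.mem_ofPred_eq] at hx hy ⊢
    simp [Finset.sum_add_distrib, hx, hy]
  zero_mem' := by simp
  smul_mem' c x hx := by
    simp only [Set.mem_ofPred_eq] at hx ⊢
    simp [← Finset.mul_sum, hx]

/-- `A_{i,s,t} = ∑_{s ≤ j < t} a_{i,j}` for `s ≤ t`, extended by `A_{i,t,s} = - A_{i,s,t}`.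
All indices are counted from `0`. -/
def translation {ℓ n : ℕ} (a : Matrix (Fin ℓ) (Fin (n - 1)) ℝ) (i : Fin ℓ) (s t : Fin n) : ℝ :=
  (∑ j : Fin (n - 1) with s.val ≤ j.val ∧ j.val < t.val, a i j)
    - ∑ j : Fin (n - 1) with t.val ≤ j.val ∧ j.val < s.val, a i j

/-- Genericity: for `i_0, …, i_k` and distinct `r_0, …, r_k`, the equality
`∑_j A_{i_j, r_{j-1}, r_j} = 0` (indices modulo `k + 1`) forces all `i_j` to coincide. -/
def IsGeneric {ℓ n : ℕ} (a : Matrix (Fin ℓ) (Fin (n - 1)) ℝ) : Prop :=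
  ∀ (k : ℕ) (i : Fin (k + 1) → Fin ℓ) (r : Fin (k + 1) → Fin n), Function.Injective r →
    ∑ j, translation a (i j) (r (j - 1)) (r j) = 0 → ∀ j j', i j = i j'

/-- The affine subspace `x_s - x_t = c` of the space `∑ x_s = 0`. -/
def braidHyperplane {n : ℕ} (s t : Fin n) (c : ℝ) : AffineSubspace ℝ (sumZero n) where
  carrier := {x | x.1 s - x.1 t = c}
  smul_vsub_vadd_mem' u p₁ p₂ p₃ h₁ h₂ h₃ := by
    simp only [Set.mem_ofPred_eq] at h₁ h₂ h₃ ⊢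
    simp only [vsub_eq_sub, vadd_eq_add, Submodule.coe_add, Submodule.coe_smul,
      Submodule.coe_sub, Pi.add_apply, Pi.smul_apply, Pi.sub_apply, smul_eq_mul]
    linear_combination u * h₁ - u * h₂ + h₃

theorem exists_mem_braidHyperplane {n : ℕ} {s t : Fin n} (hst : s ≠ t) (c : ℝ) :
    ∃ x, x ∈ braidHyperplane s t c := by
  refine ⟨⟨Pi.single s (c / 2) - Pi.single t (c / 2), ?_⟩, ?_⟩
  · change ∑ u, (Pi.single s (c / 2) - Pi.single t (c / 2) : Fin n → ℝ) u = 0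
    simp [Finset.sum_sub_distrib]
  · change (Pi.single s (c / 2) - Pi.single t (c / 2) : Fin n → ℝ) s
      - (Pi.single s (c / 2) - Pi.single t (c / 2) : Fin n → ℝ) t = c
    simp [hst, hst.symm]

theorem isCoatom_direction_braidHyperplane {n : ℕ} {s t : Fin n} (hst : s ≠ t) (c : ℝ) :
    IsCoatom (braidHyperplane s t c).direction := by
  let f : sumZero n →ₗ[ℝ] ℝ :=
    ((LinearMap.proj s : (Fin n → ℝ) →ₗ[ℝ] ℝ) - LinearMap.proj t) ∘ₗ (sumZero n).subtype
  have hf : ∀ x : sumZero n, f x = x.1 s - x.1 t := fun x => rfl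
  have hne : f ≠ 0 := by
    obtain ⟨x, hx⟩ := exists_mem_braidHyperplane hst 1
    intro h
    have h1 : f x = 1 := hx
    simp [h] at h1
  have hdir : (braidHyperplane s t c).direction = LinearMap.ker f := by
    obtain ⟨p, hp⟩ := exists_mem_braidHyperplane hst c
    have hp' : p.1 s - p.1 t = c := hp
    ext v
    rw [← AffineSubspace.vadd_mem_iff_mem_direction v hp, LinearMap.mem_ker, hf]
    change (v + p).1 s - (v + p).1 t = c ↔ _
    simp only [Submodule.coe_add, Pi.add_apply]
    constructor <;> intro h <;> linarith
  rw [hdir]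
  exact LinearMap.isCoatom_ker_of_surjective (LinearMap.surjective hne)

/-- The `a`-braid arrangement: the hyperplanes `x_s - x_t = A_{i,s,t}` with `s < t` of the space
`∑ x_s = 0`, for all copies `i`. -/
def braidArrangement {ℓ n : ℕ} (a : Matrix (Fin ℓ) (Fin (n - 1)) ℝ) :
    HyperplaneArrangement (sumZero n) where
  carrier := {H | ∃ (i : Fin ℓ) (s t : Fin n), s < t ∧
    H = braidHyperplane s t (translation a i s t)}
  finite := by
    refine (Set.finite_range fun q : Fin ℓ × Fin n × Fin n =>
      braidHyperplane q.2.1 q.2.2 (translation a q.1 q.2.1 q.2.2)).subset ?_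
    rintro H ⟨i, s, t, -, rfl⟩
    exact ⟨(i, s, t), rfl⟩
  isHyperplane := by
    rintro H ⟨i, s, t, hst, rfl⟩
    exact ⟨exists_mem_braidHyperplane hst.ne _, isCoatom_direction_braidHyperplane hst.ne _⟩

/-- The Fuss–Catalan number `F_{ℓ,m}`. -/
def fussCatalan (ℓ m : ℕ) : ℚ :=
  1 / (((ℓ : ℚ) - 1) * m + 1) * ((ℓ * m).choose m : ℚ)

/-- The power series `∑_{m ≥ 1} F_{ℓ,m} y z ^ m / m` in `z` over `ℚ[y]`. -/
noncomputable def fussCatalanSeries (ℓ : ℕ) : PowerSeries (Polynomial ℚ) :=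
  PowerSeries.mk fun m =>
    if m = 0 then 0 else Polynomial.C (fussCatalan ℓ m / m) * Polynomial.X

end MultiBraid

/-! By Whitney's theorem χ is the alternating sum of y^dim over the families of hyperplanes with
non-empty intersection, and such sums obey deletion–restriction. Call a pair (i, s) of a colour and
a vertex a token; each hyperplane joins two tokens of one colour. Consider a state in which the
coordinates outside U are rigid up to translation, p tokens on a cluster of rigid vertices are
active, and all tokens at the m vertices of U are present. Genericity makes the Whitney sum of such
a state a polynomial P(p, m) that depends on p and m only (`whitneySum_eq_tokenPoly`).

Deleting an active token gives P(p+1, m+1) = P(p, m+1) − (m+1) P(p+ℓ, m): at most one of its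
hyperplanes is used, and using one spends the token and attaches a free vertex with its ℓ tokens.
Without active tokens the rigid part floats, so P(0, m+1) = y P(ℓ, m); finally P(p, 0) = 1.

Let C = 1 + z C^ℓ and E = exp(−∑ F_{ℓ,m} y z^m / m). Then E' = −y C^ℓ E, so (−1)^m m! [z^m] E C^p
satisfies the same recursion. Since χ = P(ℓ, n−1) and P(0, n) = y P(ℓ, n−1), the formula follows. -/

namespace MultiBraid

/-! ### Fuss–Catalan series and the recursion for `tokenPoly`. -/

/-- The coefficient of `z ^ m` in the `p`-th power of the series `C = 1 + z C ^ ℓ`. -/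
def raney (ℓ p : ℕ) : ℕ → ℚ
  | 0 => 1
  | m + 1 => p / (m + 1) * ((ℓ * (m + 1) + p - 1).choose m : ℚ)

/-- This is C^(p+1) = C^p + z C^(p+ℓ), coefficientwise. After Pascal's rule all binomials have the
same top `N`, and the ratio of two neighbouring ones finishes. -/
theorem raney_succ_succ {ℓ : ℕ} (hℓ : 1 ≤ ℓ) (p m : ℕ) :
    raney ℓ (p + 1) (m + 1) = raney ℓ p (m + 1) + raney ℓ (p + ℓ) m := by
  obtain ⟨l, rfl⟩ : ∃ l, ℓ = l + 1 := ⟨ℓ - 1, by omega⟩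
  cases m with
  | zero => simp [raney]
  | succ k =>
    have e1 : (l + 1) * (k + 1 + 1) + (p + 1) - 1 = ((l + 1) * (k + 2) + p - 1) + 1 := by
      have : 1 ≤ (l + 1) * (k + 2) := Nat.mul_pos (by omega) (by omega)
      change (l + 1) * (k + 2) + (p + 1) - 1 = _
      omega
    have e2 : (l + 1) * (k + 1) + (p + (l + 1)) - 1 = (l + 1) * (k + 2) + p - 1 := by
      have : (l + 1) * (k + 2) = (l + 1) * (k + 1) + (l + 1) := by ring
      omega
    have e3 : (l + 1) * (k + 1 + 1) + p - 1 = (l + 1) * (k + 2) + p - 1 := rfl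
    simp only [raney]
    rw [e1, e2, e3, Nat.choose_succ_succ]
    set N := (l + 1) * (k + 2) + p - 1 with hN
    have hN' : (N : ℚ) = (l + 1) * (k + 2) + p - 1 := by
      have : N + 1 = (l + 1) * (k + 2) + p := by
        have : 1 ≤ (l + 1) * (k + 2) := Nat.mul_pos (by omega) (by omega)
        omega
      have h2 : (N : ℚ) + 1 = (l + 1) * (k + 2) + p := by exact_mod_cast this
      linarith
    have hkN : k ≤ N := by
      have : (l + 1) * (k + 2) = l * (k + 2) + (k + 2) := by ring
      omega
    have hb : (N.choose (k + 1) : ℚ) * (k + 1) = N.choose k * (N - k) := by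
      have := Nat.choose_succ_right_eq N k
      rw [← Nat.cast_sub hkN]
      exact_mod_cast this
    push_cast
    have h1 : (k : ℚ) + 1 ≠ 0 := by positivity
    have h2 : (k : ℚ) + 1 + 1 ≠ 0 := by positivity
    field_simp
    rw [hN'] at hb
    linear_combination hb

/-- The Fuss–Catalan numbers are the coefficients of C, and C = 1 + z C^ℓ shifts them to those of
C^ℓ. -/
theorem fussCatalan_succ {ℓ : ℕ} (hℓ : 1 ≤ ℓ) (m : ℕ) :
    fussCatalan ℓ (m + 1) = raney ℓ ℓ m := by
  have h0 : raney ℓ ℓ m = raney ℓ 1 (m + 1) := by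
    have := raney_succ_succ hℓ 0 m
    simp only [zero_add] at this
    rw [this]
    simp [raney]
  obtain ⟨l, rfl⟩ : ∃ l, ℓ = l + 1 := ⟨ℓ - 1, by omega⟩
  rw [h0, fussCatalan, raney, Nat.add_sub_cancel]
  set N := (l + 1) * (m + 1) with hN
  have hmN : m ≤ N := by
    have : (l + 1) * (m + 1) = l * (m + 1) + (m + 1) := by ring
    omega
  have hb : (N.choose (m + 1) : ℚ) * (m + 1) = N.choose m * (N - m) := by
    have := Nat.choose_succ_right_eq N m
    rw [← Nat.cast_sub hmN]
    exact_mod_cast this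
  have hN' : (N : ℚ) = (l + 1) * (m + 1) := by rw [hN]; push_cast; ring
  rw [hN'] at hb
  have h1 : (m : ℚ) + 1 ≠ 0 := by positivity
  have h2 : ((l : ℚ) * (m + 1) + 1) ≠ 0 := by positivity
  push_cast
  rw [add_sub_cancel_right]
  field_simp
  linear_combination hb

/-- The `p`-th power of the Fuss–Catalan series, over `ℚ[y]`. -/
noncomputable def raneySeries (ℓ p : ℕ) : PowerSeries (Polynomial ℚ) :=
  PowerSeries.mk fun m => Polynomial.C (raney ℓ p m)

theorem raneySeries_zero (ℓ : ℕ) : raneySeries ℓ 0 = 1 := by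
  ext1 m
  cases m <;> simp [raneySeries, raney, PowerSeries.coeff_one]

theorem raneySeries_succ {ℓ : ℕ} (hℓ : 1 ≤ ℓ) (p : ℕ) :
    raneySeries ℓ (p + 1) = raneySeries ℓ p + PowerSeries.X * raneySeries ℓ (p + ℓ) := by
  ext1 m
  cases m with
  | zero => simp [raneySeries, raney]
  | succ m =>
    simp [raneySeries, raney_succ_succ hℓ, PowerSeries.coeff_succ_X_mul]

/-- The series `exp (- ∑ F_{ℓ,m} y z ^ m / m)`. -/
noncomputable def expSeries (ℓ : ℕ) : PowerSeries (Polynomial ℚ) :=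
  (PowerSeries.exp ℚ).subst (-fussCatalanSeries ℓ)

theorem constantCoeff_fussCatalanSeries (ℓ : ℕ) :
    PowerSeries.constantCoeff (-fussCatalanSeries ℓ) = 0 := by
  rw [map_neg, ← PowerSeries.coeff_zero_eq_constantCoeff_apply]
  simp [fussCatalanSeries]

/-- Puts the exponential over ℚ[y], the form in which the chain rule is applied to it. -/
theorem expSeries_eq (ℓ : ℕ) :
    expSeries ℓ = (PowerSeries.exp (Polynomial ℚ)).subst (-fussCatalanSeries ℓ) := by
  have hs := PowerSeries.HasSubst.of_constantCoeff_zero' (constantCoeff_fussCatalanSeries ℓ)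
  ext1 m
  rw [expSeries, PowerSeries.coeff_subst' hs, PowerSeries.coeff_subst' hs]
  simp only [PowerSeries.coeff_exp, algebraMap_smul, Algebra.algebraMap_self_apply]

theorem derivative_fussCatalanSeries {ℓ : ℕ} (hℓ : 1 ≤ ℓ) :
    PowerSeries.derivative (Polynomial ℚ) (fussCatalanSeries ℓ) =
      PowerSeries.C Polynomial.X * raneySeries ℓ ℓ := by
  ext1 m
  rw [PowerSeries.coeff_derivative, PowerSeries.coeff_C_mul, fussCatalanSeries, raneySeries,
    PowerSeries.coeff_mk, PowerSeries.coeff_mk, if_neg m.succ_ne_zero, fussCatalan_succ hℓ]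
  have h1 : ((m + 1 : ℕ) : ℚ) ≠ 0 := by positivity
  have h2 : ((m : Polynomial ℚ) + 1) = Polynomial.C ((m + 1 : ℕ) : ℚ) := by simp
  rw [h2, mul_right_comm, ← Polynomial.C_mul, div_mul_cancel₀ _ h1, mul_comm]

theorem derivative_expSeries {ℓ : ℕ} (hℓ : 1 ≤ ℓ) :
    PowerSeries.derivative (Polynomial ℚ) (expSeries ℓ) =
      -(PowerSeries.C Polynomial.X * (expSeries ℓ * raneySeries ℓ ℓ)) := by
  have hs := PowerSeries.HasSubst.of_constantCoeff_zero' (constantCoeff_fussCatalanSeries ℓ)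
  rw [expSeries_eq, PowerSeries.derivative_subst hs, PowerSeries.derivative_exp, map_neg,
    derivative_fussCatalanSeries hℓ]
  ring

theorem coeff_zero_expSeries (ℓ : ℕ) : PowerSeries.coeff 0 (expSeries ℓ) = 1 := by
  have hs := PowerSeries.HasSubst.of_constantCoeff_zero' (constantCoeff_fussCatalanSeries ℓ)
  rw [expSeries, PowerSeries.coeff_subst' hs, finsum_eq_single _ 0]
  · simp
  · intro d hd
    rw [PowerSeries.coeff_zero_eq_constantCoeff_apply, map_pow, constantCoeff_fussCatalanSeries,
      zero_pow hd, smul_zero]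

/-- The polynomial counting extensions of a rigid cluster with `p` active tokens by `m` free
vertices. -/
noncomputable def tokenPoly (ℓ p m : ℕ) : Polynomial ℚ :=
  (-1) ^ m * (m ! : Polynomial ℚ) * PowerSeries.coeff m (expSeries ℓ * raneySeries ℓ p)

theorem tokenPoly_zero_right (ℓ p : ℕ) : tokenPoly ℓ p 0 = 1 := by
  have : PowerSeries.coeff 0 (raneySeries ℓ p) = 1 := by simp [raneySeries, raney]
  rw [PowerSeries.coeff_zero_eq_constantCoeff_apply] at this
  have h := coeff_zero_expSeries ℓ
  rw [PowerSeries.coeff_zero_eq_constantCoeff_apply] at h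
  simp [tokenPoly, this, h]

/-- Multiply C^(p+1) = C^p + z C^(p+ℓ) by E; the factor m + 1 comes from (m+1)!. -/
theorem tokenPoly_succ_succ {ℓ : ℕ} (hℓ : 1 ≤ ℓ) (p m : ℕ) :
    tokenPoly ℓ (p + 1) (m + 1) = tokenPoly ℓ p (m + 1) - (m + 1) * tokenPoly ℓ (p + ℓ) m := by
  simp only [tokenPoly]
  rw [raneySeries_succ hℓ, mul_add, mul_left_comm, map_add, PowerSeries.coeff_succ_X_mul,
    Nat.factorial_succ]
  push_cast
  ring

/-- The coefficient of z^m in E' = −y C^ℓ E. -/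
theorem tokenPoly_zero_succ {ℓ : ℕ} (hℓ : 1 ≤ ℓ) (m : ℕ) :
    tokenPoly ℓ 0 (m + 1) = Polynomial.X * tokenPoly ℓ ℓ m := by
  have h := congrArg (PowerSeries.coeff m) (derivative_expSeries hℓ)
  rw [PowerSeries.coeff_derivative, map_neg, PowerSeries.coeff_C_mul] at h
  simp only [tokenPoly]
  rw [raneySeries_zero, mul_one, Nat.factorial_succ]
  push_cast
  linear_combination (-1) ^ (m + 1) * (m ! : Polynomial ℚ) * h

theorem tokenPoly_zero_left (ℓ n : ℕ) :
    tokenPoly ℓ 0 n = (-1) ^ n * (n ! : Polynomial ℚ) * PowerSeries.coeff n (expSeries ℓ) := by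
  rw [tokenPoly, raneySeries_zero, mul_one]

end MultiBraid

/-! ### Whitney sums, deletion–restriction and Whitney's theorem. -/

namespace HyperplaneArrangement

variable {V : Type*} [AddCommGroup V] [Module ℝ V]

open Classical in
/-- `X ^ dim F` for a nonempty affine subspace `F`, and `0` for the empty one. -/
noncomputable def flatWeight (F : AffineSubspace ℝ V) : Polynomial ℚ :=
  if (F : Set V).Nonempty then Polynomial.X ^ Module.finrank ℝ F.direction else 0

theorem flatWeight_bot : flatWeight (⊥ : AffineSubspace ℝ V) = 0 := by
  simp [flatWeight]

/-- The Whitney sum `∑_{B ⊆ I} (-1) ^ |B| X ^ dim (K ∩ ⋂ B)` over the subfamilies `B` that meet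
inside `K`. -/
noncomputable def whitneySum (K : AffineSubspace ℝ V) (I : Finset (AffineSubspace ℝ V)) :
    Polynomial ℚ :=
  ∑ B ∈ I.powerset, (-1) ^ B.card * flatWeight (K ⊓ B.inf id)

theorem whitneySum_empty (K : AffineSubspace ℝ V) : whitneySum K ∅ = flatWeight K := by
  simp [whitneySum]

theorem whitneySum_bot (I : Finset (AffineSubspace ℝ V)) : whitneySum ⊥ I = 0 := by
  simp [whitneySum, flatWeight_bot]

open Classical in
theorem whitneySum_insert_of_notMem (K : AffineSubspace ℝ V) {e : AffineSubspace ℝ V}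
    {I : Finset (AffineSubspace ℝ V)} (he : e ∉ I) :
    whitneySum K (insert e I) = whitneySum K I - whitneySum (K ⊓ e) I := by
  simp only [whitneySum]
  rw [Finset.sum_powerset_insert he, sub_eq_add_neg, ← Finset.sum_neg_distrib]
  congr 1
  refine Finset.sum_congr rfl fun B hB => ?_
  have heB : e ∉ B := fun h => he (Finset.mem_powerset.1 hB h)
  rw [Finset.card_insert_of_notMem heB, Finset.inf_insert, id, inf_assoc]
  ring

/-- Adding or removing f changes the sign of a family but not its trace on K, so the terms cancel in
pairs. -/
theorem whitneySum_eq_zero_of_le {K f : AffineSubspace ℝ V} {I : Finset (AffineSubspace ℝ V)}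
    (hf : f ∈ I) (hK : K ≤ f) : whitneySum K I = 0 := by
  classical
  rw [← Finset.insert_erase hf, whitneySum_insert_of_notMem _ (Finset.notMem_erase f I),
    inf_eq_left.2 hK, sub_self]

-- Deletion–restriction. It also holds for e in I, where the restricted sum vanishes; hence
-- restrictions never require discarding duplicates.
open Classical in
theorem whitneySum_insert (K e : AffineSubspace ℝ V) (I : Finset (AffineSubspace ℝ V)) :
    whitneySum K (insert e I) = whitneySum K I - whitneySum (K ⊓ e) I := by
  by_cases he : e ∈ I
  · rw [Finset.insert_eq_of_mem he, whitneySum_eq_zero_of_le he inf_le_right, sub_zero]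
  · exact whitneySum_insert_of_notMem K he

open Classical in
/-- Hyperplanes that do not meet `K`, or whose trace on `K` lies in a member of `I`, may be
added to `I`. -/
theorem whitneySum_union_of_le (K : AffineSubspace ℝ V) (I E : Finset (AffineSubspace ℝ V))
    (h : ∀ e ∈ E, K ⊓ e = ⊥ ∨ ∃ f ∈ I, K ⊓ e ≤ f) : whitneySum K (I ∪ E) = whitneySum K I := by
  induction E using Finset.induction_on with
  | empty => rw [Finset.union_empty]
  | insert e E _ ih =>
    rw [Finset.union_insert, whitneySum_insert,
      ih fun e' he' => h e' (Finset.mem_insert_of_mem he')]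
    have : whitneySum (K ⊓ e) (I ∪ E) = 0 := by
      obtain h1 | ⟨f, hf, hle⟩ := h e (Finset.mem_insert_self e E)
      · rw [h1, whitneySum_bot]
      · exact whitneySum_eq_zero_of_le (Finset.mem_union_left _ hf) hle
    rw [this, sub_zero]

open Classical in
/-- Adding hyperplanes whose pairwise intersections are absorbed by `I`. -/
theorem whitneySum_union_image {ι : Type*} (K : AffineSubspace ℝ V)
    (I : Finset (AffineSubspace ℝ V)) (U : Finset ι) (g : ι → AffineSubspace ℝ V)
    (h : ∀ u ∈ U, ∀ v ∈ U, u ≠ v → ∃ f ∈ I, K ⊓ g u ⊓ g v ≤ f) :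
    whitneySum K (I ∪ U.image g) = whitneySum K I - ∑ u ∈ U, whitneySum (K ⊓ g u) I := by
  induction U using Finset.induction_on with
  | empty => simp
  | insert u U hu ih =>
    rw [Finset.image_insert, Finset.union_insert, whitneySum_insert, Finset.sum_insert hu,
      ih fun v hv w hw => h v (Finset.mem_insert_of_mem hv) w (Finset.mem_insert_of_mem hw),
      whitneySum_union_of_le (K ⊓ g u)]
    · ring
    · intro e he
      obtain ⟨v, hv, rfl⟩ := Finset.mem_image.1 he
      exact Or.inr (h u (Finset.mem_insert_self u U) v (Finset.mem_insert_of_mem hv)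
        (fun huv => hu (huv ▸ hv)))

variable (𝒜 : HyperplaneArrangement V)

open Classical in
/-- The signed number of subfamilies of hyperplanes with intersection `F`. -/
noncomputable def signedCount (F : AffineSubspace ℝ V) : ℤ :=
  ∑ B ∈ 𝒜.finite.toFinset.powerset with B.inf id = F, (-1) ^ B.card

theorem isFlat_inf {B : Finset (AffineSubspace ℝ V)} (hB : B ⊆ 𝒜.finite.toFinset)
    (hne : ((B.inf id : AffineSubspace ℝ V) : Set V).Nonempty) : 𝒜.IsFlat (B.inf id) :=
  ⟨hne, B, fun _ hH => 𝒜.finite.mem_toFinset.1 (hB hH), Finset.inf_id_eq_sInf B⟩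

-- The left side is the alternating sum over all families of hyperplanes containing G. It vanishes
-- unless no hyperplane contains G, that is, unless G is the whole space.
open Classical in
theorem sum_signedCount (G : 𝒜.FlatPoset) :
    ∑ F ∈ Finset.Icc 𝒜.ambientFlat G, 𝒜.signedCount (OrderDual.ofDual F.1) =
      if 𝒜.ambientFlat = G then 1 else 0 := by
  obtain ⟨G, hG⟩ := G
  set G' : AffineSubspace ℝ V := OrderDual.ofDual G with hG'
  have hmaps : ∀ B ∈ 𝒜.finite.toFinset.powerset.filter (fun B => G' ≤ B.inf id),
      𝒜.IsFlat (B.inf id) := by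
    intro B hB
    rw [Finset.mem_filter, Finset.mem_powerset] at hB
    exact 𝒜.isFlat_inf hB.1 (hG.1.mono hB.2)
  have h1 : ∑ F ∈ Finset.Icc 𝒜.ambientFlat ⟨G, hG⟩, 𝒜.signedCount (OrderDual.ofDual F.1) =
      ∑ B ∈ 𝒜.finite.toFinset.powerset with G' ≤ B.inf id, (-1) ^ B.card := by
    simp only [signedCount]
    rw [Finset.sum_sigma']
    refine Finset.sum_bij (fun x _ => x.2) ?_ ?_ ?_ ?_
    · rintro ⟨F, B⟩ hx
      simp only [Finset.mem_sigma, Finset.mem_filter, Finset.mem_Icc] at hx ⊢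
      refine ⟨hx.2.1, ?_⟩
      rw [hx.2.2]
      exact hx.1.2
    · rintro ⟨F, B⟩ hx ⟨F', B'⟩ hx' h
      simp only [Finset.mem_sigma, Finset.mem_filter] at hx hx'
      simp only at h
      subst h
      have : F = F' := Subtype.ext (hx.2.2.symm.trans hx'.2.2)
      subst this
      rfl
    · intro B hB
      refine ⟨⟨⟨OrderDual.toDual (B.inf id), hmaps B hB⟩, B⟩, ?_, rfl⟩
      rw [Finset.mem_filter] at hB
      simp only [Finset.mem_sigma, Finset.mem_filter, Finset.mem_Icc]
      exact ⟨⟨show B.inf id ≤ ⊤ from le_top, show G' ≤ B.inf id from hB.2⟩, hB.1, rfl⟩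
    · rintro ⟨F, B⟩ _
      rfl
  have h2 : (𝒜.finite.toFinset.powerset.filter fun B => G' ≤ B.inf id) =
      (𝒜.finite.toFinset.filter fun H => G' ≤ H).powerset := by
    ext B
    simp only [Finset.mem_filter, Finset.mem_powerset, Finset.le_inf_iff, id, Finset.subset_iff]
    exact ⟨fun h H hH => ⟨h.1 hH, h.2 H hH⟩, fun h => ⟨fun H hH => (h hH).1, fun H hH => (h hH).2⟩⟩
  rw [h1, h2, Finset.sum_powerset_neg_one_pow_card]
  refine if_congr ?_ rfl rfl
  obtain ⟨S, hS, hGS⟩ := hG.2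
  constructor
  · intro h
    have hSe : S = ∅ := by
      rw [Set.eq_empty_iff_forall_notMem]
      intro H hH
      have : H ∈ (𝒜.finite.toFinset.filter fun H => G' ≤ H) := by
        rw [Finset.mem_filter, Set.Finite.mem_toFinset]
        exact ⟨hS hH, hGS ▸ sInf_le hH⟩
      rw [h] at this
      exact absurd this (Finset.notMem_empty _)
    rw [hSe, sInf_empty] at hGS
    exact Subtype.ext hGS.symm
  · intro h
    have hG1 : G' = ⊤ := (congrArg Subtype.val h).symm
    rw [Finset.filter_eq_empty_iff]
    intro H hH hle
    have h3 : H = ⊤ := top_le_iff.1 (hG1 ▸ hle)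
    have h4 := (𝒜.isHyperplane H (𝒜.finite.mem_toFinset.1 hH)).2.1
    rw [h3, AffineSubspace.direction_top] at h4
    exact h4 rfl

-- Both sides satisfy the recursion that defines the Möbius function.
open Classical in
theorem mu_eq_signedCount (G : 𝒜.FlatPoset) :
    IncidenceAlgebra.mu ℤ 𝒜.ambientFlat G = 𝒜.signedCount (OrderDual.ofDual G.1) := by
  induction G using WellFoundedLT.induction with
  | ind G ih =>
    have hle : 𝒜.ambientFlat ≤ G := show OrderDual.ofDual G.1 ≤ ⊤ from le_top
    have h1 := IncidenceAlgebra.sum_Icc_mu_right (𝕜 := ℤ) 𝒜.ambientFlat G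
    have h2 := 𝒜.sum_signedCount G
    rw [← Finset.Ico_insert_right hle, Finset.sum_insert Finset.right_notMem_Ico] at h1 h2
    have h3 : ∑ x ∈ Finset.Ico 𝒜.ambientFlat G, IncidenceAlgebra.mu ℤ 𝒜.ambientFlat x =
        ∑ x ∈ Finset.Ico 𝒜.ambientFlat G, 𝒜.signedCount (OrderDual.ofDual x.1) :=
      Finset.sum_congr rfl fun x hx => ih x (Finset.mem_Ico.1 hx).2
    linarith

/-- Whitney's theorem. -/
theorem map_charPoly : 𝒜.charPoly.map (Int.castRingHom ℚ) = whitneySum ⊤ 𝒜.finite.toFinset := by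
  classical
  simp only [charPoly, mu_eq_signedCount, whitneySum, top_inf_eq, signedCount]
  have hvan : ∑ B ∈ 𝒜.finite.toFinset.powerset,
        (-1 : Polynomial ℚ) ^ B.card * flatWeight (B.inf id) =
      ∑ B ∈ 𝒜.finite.toFinset.powerset with
        ((B.inf id : AffineSubspace ℝ V) : Set V).Nonempty,
        (-1 : Polynomial ℚ) ^ B.card * flatWeight (B.inf id) := by
    refine (Finset.sum_filter_of_ne fun B _ h => ?_).symm
    by_contra hne
    exact h (by rw [flatWeight, if_neg hne, mul_zero])
  rw [hvan, Polynomial.map_sum]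
  simp only [map_sum, Finset.sum_mul, Polynomial.map_sum]
  rw [Finset.sum_sigma']
  refine Finset.sum_bij (fun x _ => x.2) ?_ ?_ ?_ ?_
  · rintro ⟨F, B⟩ hx
    simp only [Finset.mem_sigma, Finset.mem_filter] at hx ⊢
    exact ⟨hx.2.1, hx.2.2 ▸ F.2.1⟩
  · rintro ⟨F, B⟩ hx ⟨F', B'⟩ hx' h
    simp only [Finset.mem_sigma, Finset.mem_filter] at hx hx'
    simp only at h
    subst h
    have : F = F' := Subtype.ext (hx.2.2.symm.trans hx'.2.2)
    subst this
    rfl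
  · intro B hB
    rw [Finset.mem_filter] at hB
    refine ⟨⟨⟨OrderDual.toDual (B.inf id), 𝒜.isFlat_inf (Finset.mem_powerset.1 hB.1) hB.2⟩, B⟩,
      ?_, rfl⟩
    simp only [Finset.mem_sigma, Finset.mem_filter, Finset.mem_univ, true_and]
    exact ⟨hB.1, rfl⟩
  · rintro ⟨F, B⟩ hx
    simp only [Finset.mem_sigma, Finset.mem_filter] at hx
    have hF : B.inf id = OrderDual.ofDual F.1 := hx.2.2
    simp only [flatWeight, hF, if_pos F.2.1, flatDim]
    rw [← hF]
    simp

/-- A direction along which `F` is invariant and which is transverse to the hyperplane `f = d`. -/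
theorem flatWeight_eq_X_mul [FiniteDimensional ℝ V] {F H : AffineSubspace ℝ V} (f : V →ₗ[ℝ] ℝ)
    (d : ℝ) (hH : ∀ x, x ∈ H ↔ f x = d) (z : V) (hz : f z = 1)
    (hF : ∀ x ∈ F, ∀ r : ℝ, x + r • z ∈ F) :
    flatWeight F = Polynomial.X * flatWeight (F ⊓ H) := by
  by_cases hne : (F : Set V).Nonempty
  · obtain ⟨x, hx⟩ := hne
    have hx' : x ∈ F := hx
    set p := x + (d - f x) • z with hp
    have hpF : p ∈ F := hF x hx' _
    have hpH : p ∈ H := by rw [hH, hp]; simp [hz]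
    have hdirH : H.direction = LinearMap.ker f := by
      ext v
      rw [← AffineSubspace.vadd_mem_iff_mem_direction v hpH, hH, LinearMap.mem_ker, vadd_eq_add,
        map_add, (hH p).1 hpH, add_eq_right]
    have hzF : z ∈ F.direction := by
      rw [← AffineSubspace.vadd_mem_iff_mem_direction z hpF, vadd_eq_add, add_comm]
      simpa using hF p hpF 1
    have hdim : Module.finrank ℝ F.direction =
        Module.finrank ℝ (F.direction ⊓ LinearMap.ker f : Submodule ℝ V) + 1 := by
      have hr := (f.domRestrict F.direction).finrank_range_add_finrank_ker
      have hsurj : LinearMap.range (f.domRestrict F.direction) = ⊤ := by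
        refine LinearMap.range_eq_top.2 (LinearMap.surjective fun h => ?_)
        have : f.domRestrict F.direction ⟨z, hzF⟩ = 1 := hz
        rw [h] at this
        simp at this
      have hker : Module.finrank ℝ (LinearMap.ker (f.domRestrict F.direction)) =
          Module.finrank ℝ (F.direction ⊓ LinearMap.ker f : Submodule ℝ V) := by
        rw [LinearMap.ker_domRestrict, ← Submodule.finrank_map_subtype_eq,
          Submodule.map_comap_subtype]
      rw [hsurj, finrank_top, Module.finrank_self, hker] at hr
      omega
    have hFH : ((F ⊓ H : AffineSubspace ℝ V) : Set V).Nonempty := ⟨p, hpF, hpH⟩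
    rw [flatWeight, flatWeight, if_pos ⟨x, hx⟩, if_pos hFH,
      AffineSubspace.direction_inf_of_mem hpF hpH, hdirH, hdim, pow_succ']
  · have hne' : ¬ ((F ⊓ H : AffineSubspace ℝ V) : Set V).Nonempty :=
      fun h => hne (h.mono inf_le_left)
    rw [flatWeight, flatWeight, if_neg hne, if_neg hne', mul_zero]

end HyperplaneArrangement

/-! ### Rigid subspaces and token hyperplanes. -/

namespace MultiBraid

open HyperplaneArrangement

variable {ℓ n : ℕ} (a : Matrix (Fin ℓ) (Fin (n - 1)) ℝ)

/-- The potential of which the translations are the differences. -/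
def potential (i : Fin ℓ) (s : Fin n) : ℝ :=
  -∑ j : Fin (n - 1) with j.val < s.val, a i j

/-- Within one colour the translations are differences of a potential, so they add up along paths
and cancel around cycles. -/
theorem translation_eq (i : Fin ℓ) (s t : Fin n) :
    translation a i s t = potential a i s - potential a i t := by
  simp only [translation, potential, Finset.sum_filter]
  rw [neg_sub_neg, ← Finset.sum_sub_distrib, ← Finset.sum_sub_distrib]
  refine Finset.sum_congr rfl fun j _ => ?_
  split_ifs <;> first | omega | simp

theorem mem_braidHyperplane {s t : Fin n} {d : ℝ} {x : sumZero n} :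
    x ∈ braidHyperplane s t d ↔ x.1 s - x.1 t = d := Iff.rfl

/-- The points of `∑ x_s = 0` whose coordinates outside `U` form a translate of `c`. -/
def rigidSubspace (c : Fin n → ℝ) (U : Finset (Fin n)) : AffineSubspace ℝ (sumZero n) where
  carrier := {x | ∀ s ∉ U, ∀ t ∉ U, x.1 s - x.1 t = c s - c t}
  smul_vsub_vadd_mem' u p₁ p₂ p₃ h₁ h₂ h₃ := by
    simp only [Set.mem_ofPred_eq] at h₁ h₂ h₃ ⊢
    intro s hs t ht
    simp only [vsub_eq_sub, vadd_eq_add, Submodule.coe_add, Submodule.coe_smul,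
      Submodule.coe_sub, Pi.add_apply, Pi.smul_apply, Pi.sub_apply, smul_eq_mul]
    linear_combination u * h₁ s hs t ht - u * h₂ s hs t ht + h₃ s hs t ht

theorem mem_rigidSubspace {c : Fin n → ℝ} {U : Finset (Fin n)} {x : sumZero n} :
    x ∈ rigidSubspace c U ↔ ∀ s ∉ U, ∀ t ∉ U, x.1 s - x.1 t = c s - c t := Iff.rfl

/-- A hyperplane from a rigid vertex s to a free vertex t pins t, so restricting to it yields a
state of the same kind. -/
theorem rigidSubspace_inf_braidHyperplane (c : Fin n → ℝ) {U : Finset (Fin n)} {s t : Fin n}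
    (hs : s ∉ U) (ht : t ∈ U) (d : ℝ) :
    rigidSubspace c U ⊓ braidHyperplane s t d =
      rigidSubspace (Function.update c t (c s - d)) (U.erase t) := by
  have hst : s ≠ t := fun h => hs (h ▸ ht)
  ext x
  rw [AffineSubspace.mem_inf_iff, mem_rigidSubspace, mem_rigidSubspace, mem_braidHyperplane]
  constructor
  · rintro ⟨h, hd⟩ p hp q hq
    rw [Finset.mem_erase, not_and] at hp hq
    by_cases hpt : p = t <;> by_cases hqt : q = t
    · rw [hpt, hqt, sub_self, sub_self]
    · rw [hpt, Function.update_self, Function.update_of_ne hqt]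
      linarith [h s hs q (hq hqt)]
    · rw [hqt, Function.update_self, Function.update_of_ne hpt]
      linarith [h p (hp hpt) s hs]
    · rw [Function.update_of_ne hpt, Function.update_of_ne hqt]
      exact h p (hp hpt) q (hq hqt)
  · intro h
    constructor
    · intro p hp q hq
      have hpt : p ≠ t := fun h => hp (h ▸ ht)
      have hqt : q ≠ t := fun h => hq (h ▸ ht)
      have := h p (fun h => hp (Finset.mem_of_mem_erase h)) q
        (fun h => hq (Finset.mem_of_mem_erase h))
      rwa [Function.update_of_ne hpt, Function.update_of_ne hqt] at this
    · have := h s (fun h => hs (Finset.mem_of_mem_erase h)) t (Finset.notMem_erase t U)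
      rw [Function.update_of_ne hst, Function.update_self] at this
      linarith

theorem flatWeight_rigidSubspace_empty (c : Fin n → ℝ) :
    flatWeight (rigidSubspace c ∅) = 1 := by
  have hx : (fun s => c s - (∑ t, c t) / n) ∈ sumZero n := by
    change ∑ s, (c s - (∑ t, c t) / n) = 0
    rcases Nat.eq_zero_or_pos n with rfl | hn
    · simp
    · have : (n : ℝ) ≠ 0 := by positivity
      rw [Finset.sum_sub_distrib, Finset.sum_const, Finset.card_univ, Fintype.card_fin,
        nsmul_eq_mul, mul_div_cancel₀ _ this, sub_self]
  set p : sumZero n := ⟨_, hx⟩ with hp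
  have hpK : p ∈ rigidSubspace c ∅ := by
    intro s _ t _
    simp [hp]
  have hdir : (rigidSubspace c ∅).direction = ⊥ := by
    rw [eq_bot_iff]
    intro v hv
    rw [← AffineSubspace.vadd_mem_iff_mem_direction v hpK, mem_rigidSubspace] at hv
    have hconst : ∀ s t, v.1 s = v.1 t := by
      intro s t
      have h1 := hv s (Finset.notMem_empty s) t (Finset.notMem_empty t)
      have h2 := hpK s (Finset.notMem_empty s) t (Finset.notMem_empty t)
      simp only [vadd_eq_add, Submodule.coe_add, Pi.add_apply] at h1
      linarith
    rw [Submodule.mem_bot]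
    ext s
    have hsum : ∑ t, v.1 t = 0 := v.2
    have hn : (n : ℝ) ≠ 0 := by
      have := s.pos
      positivity
    rw [Finset.sum_congr rfl fun t _ => hconst t s, Finset.sum_const, Finset.card_univ,
      Fintype.card_fin, nsmul_eq_mul] at hsum
    exact (mul_eq_zero.1 hsum).resolve_left hn
  rw [flatWeight, if_pos ⟨p, hpK⟩, hdir, finrank_bot, pow_zero]

/-- The hyperplanes joining two tokens `(i, s)`, `(i, t)` of the same colour in `Z`. -/
def tokenHyperplanes (Z : Finset (Fin ℓ × Fin n)) : Set (AffineSubspace ℝ (sumZero n)) :=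
  {H | ∃ i s t, (i, s) ∈ Z ∧ (i, t) ∈ Z ∧ s ≠ t ∧ H = braidHyperplane s t (translation a i s t)}

theorem finite_tokenHyperplanes (Z : Finset (Fin ℓ × Fin n)) : (tokenHyperplanes a Z).Finite := by
  refine (Set.finite_range fun q : Fin ℓ × Fin n × Fin n =>
    braidHyperplane q.2.1 q.2.2 (translation a q.1 q.2.1 q.2.2)).subset ?_
  rintro H ⟨i, s, t, -, -, -, rfl⟩
  exact ⟨(i, s, t), rfl⟩

/-- The finite set of hyperplanes joining two tokens of the same colour in `Z`. -/
noncomputable def tokenFinset (Z : Finset (Fin ℓ × Fin n)) :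
    Finset (AffineSubspace ℝ (sumZero n)) :=
  (finite_tokenHyperplanes a Z).toFinset

theorem mem_tokenFinset {Z : Finset (Fin ℓ × Fin n)} {H : AffineSubspace ℝ (sumZero n)} :
    H ∈ tokenFinset a Z ↔ ∃ i s t, (i, s) ∈ Z ∧ (i, t) ∈ Z ∧ s ≠ t ∧
      H = braidHyperplane s t (translation a i s t) :=
  (finite_tokenHyperplanes a Z).mem_toFinset

theorem braidHyperplane_translation_comm (i : Fin ℓ) (s t : Fin n) :
    braidHyperplane s t (translation a i s t) = braidHyperplane t s (translation a i t s) := by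
  ext x
  rw [mem_braidHyperplane, mem_braidHyperplane, translation_eq, translation_eq]
  constructor <;> intro h <;> linarith

theorem tokenFinset_univ : tokenFinset a Finset.univ = (braidArrangement a).finite.toFinset := by
  ext H
  rw [mem_tokenFinset, Set.Finite.mem_toFinset]
  constructor
  · rintro ⟨i, s, t, -, -, hst, rfl⟩
    rcases hst.lt_or_gt with h | h
    · exact ⟨i, s, t, h, rfl⟩
    · exact ⟨i, t, s, h, braidHyperplane_translation_comm a i s t⟩
  · rintro ⟨i, s, t, hst, rfl⟩
    exact ⟨i, s, t, Finset.mem_univ _, Finset.mem_univ _, hst.ne, rfl⟩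

open Classical in
theorem tokenFinset_insert (Z : Finset (Fin ℓ × Fin n)) (i : Fin ℓ) (s : Fin n) :
    tokenFinset a (insert (i, s) Z) = tokenFinset a Z ∪
      ({t | (i, t) ∈ Z ∧ t ≠ s} : Finset (Fin n)).image fun t =>
        braidHyperplane s t (translation a i s t) := by
  ext H
  rw [Finset.mem_union, mem_tokenFinset, mem_tokenFinset, Finset.mem_image]
  simp only [Finset.mem_insert, Prod.mk.injEq, Finset.mem_filter, Finset.mem_univ, true_and]
  constructor
  · rintro ⟨j, p, q, ⟨rfl, rfl⟩ | hp, ⟨hj, rfl⟩ | hq, hpq, rfl⟩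
    · exact absurd rfl hpq
    · exact Or.inr ⟨q, ⟨hq, hpq.symm⟩, rfl⟩
    · subst hj
      exact Or.inr ⟨p, ⟨hp, hpq⟩, (braidHyperplane_translation_comm a j p q).symm⟩
    · exact Or.inl ⟨j, p, q, hp, hq, hpq, rfl⟩
  · rintro (⟨j, p, q, hp, hq, hpq, rfl⟩ | ⟨t, ⟨ht, hts⟩, rfl⟩)
    · exact ⟨j, p, q, Or.inr hp, Or.inr hq, hpq, rfl⟩
    · exact ⟨i, s, t, Or.inl ⟨rfl, rfl⟩, Or.inr ht, hts.symm, rfl⟩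

-- Two of the new hyperplanes, towards u and v, meet inside the hyperplane of the same colour
-- joining u and v. That one is already present, so terms using two new hyperplanes cancel.
open Classical in
theorem whitneySum_tokenFinset_insert (K : AffineSubspace ℝ (sumZero n))
    (Z : Finset (Fin ℓ × Fin n)) (i : Fin ℓ) (s : Fin n) :
    whitneySum K (tokenFinset a (insert (i, s) Z)) = whitneySum K (tokenFinset a Z) -
      ∑ t : Fin n with (i, t) ∈ Z ∧ t ≠ s,
        whitneySum (K ⊓ braidHyperplane s t (translation a i s t)) (tokenFinset a Z) := by
  rw [tokenFinset_insert]
  refine whitneySum_union_image _ _ _ _ fun u hu v hv huv => ?_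
  rw [Finset.mem_filter] at hu hv
  refine ⟨braidHyperplane u v (translation a i u v),
    (mem_tokenFinset a).2 ⟨i, u, v, hu.2.1, hv.2.1, huv, rfl⟩, ?_⟩
  rintro x ⟨⟨-, h1⟩, h2⟩
  have h1' : x.1 s - x.1 u = translation a i s u := h1
  have h2' : x.1 s - x.1 v = translation a i s v := h2
  change x.1 u - x.1 v = translation a i u v
  rw [translation_eq] at *
  linarith

/-! ### Clusters and genericity. -/

/-- `s` and `t` are joined by a simple path in `L` along which the translations add up to
`c s - c t`. -/
def Linked (c : Fin n → ℝ) (L : Finset (Fin n)) (s t : Fin n) : Prop :=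
  ∃ (k : ℕ) (r : Fin (k + 1) → Fin n) (e : Fin k → Fin ℓ), Function.Injective r ∧
    (∀ j, r j ∈ L) ∧ r 0 = s ∧ r (Fin.last k) = t ∧
    ∑ j, translation a (e j) (r j.castSucc) (r j.succ) = c s - c t

/-- Any two elements of `L` are linked. -/
def IsCluster (c : Fin n → ℝ) (L : Finset (Fin n)) : Prop :=
  ∀ s ∈ L, ∀ t ∈ L, Linked a c L s t

variable {a} in
theorem linked_self (c : Fin n → ℝ) {L : Finset (Fin n)} {s : Fin n} (hs : s ∈ L) :
    Linked a c L s s :=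
  ⟨0, fun _ => s, Fin.elim0, fun x y _ => Subsingleton.elim (α := Fin 1) x y, fun _ => hs, rfl, rfl, by simp⟩

theorem isCluster_singleton (c : Fin n → ℝ) (u : Fin n) : IsCluster a c {u} := by
  intro s hs t ht
  rw [Finset.mem_singleton] at hs ht
  subst hs ht
  exact linked_self c (Finset.mem_singleton_self _)

-- The new vertex is a leaf attached at s₀: paths extended by it remain simple because u ∉ L.
variable {a} in
theorem IsCluster.insert {c c' : Fin n → ℝ} {L : Finset (Fin n)} (h : IsCluster a c L)
    {u s₀ : Fin n} (hu : u ∉ L) (hs₀ : s₀ ∈ L) (i : Fin ℓ) (hc : ∀ s ∈ L, c' s = c s)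
    (hcu : c' u = c s₀ - translation a i s₀ u) : IsCluster a c' (insert u L) := by
  intro s hs t ht
  rw [Finset.mem_insert] at hs ht
  rcases hs with rfl | hs <;> rcases ht with rfl | ht
  · exact linked_self c' (Finset.mem_insert_self _ _)
  · obtain ⟨k, r, e, hr, hrL, h0, hlast, hsum⟩ := h s₀ hs₀ t ht
    refine ⟨k + 1, Fin.cons s r, Fin.cons i e, ?_, ?_, rfl, ?_, ?_⟩
    · rw [Fin.cons_injective_iff]
      refine ⟨?_, hr⟩
      rintro ⟨j, rfl⟩
      exact hu (hrL j)
    · intro j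
      refine Fin.cases ?_ (fun j => ?_) j
      · simp
      · simp [hrL j]
    · rw [← Fin.succ_last, Fin.cons_succ, hlast]
    · rw [Fin.sum_univ_succ]
      simp only [Fin.cons_zero, Fin.castSucc_zero, Fin.cons_succ, Fin.castSucc_succ]
      rw [hsum, h0, hcu, hc t ht, translation_eq, translation_eq]
      ring
  · obtain ⟨k, r, e, hr, hrL, h0, hlast, hsum⟩ := h s hs s₀ hs₀
    refine ⟨k + 1, Fin.snoc r t, Fin.snoc e i, ?_, ?_, ?_, ?_, ?_⟩
    · rw [Fin.snoc_injective_iff]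
      refine ⟨hr, ?_⟩
      rintro ⟨j, rfl⟩
      exact hu (hrL j)
    · intro j
      refine Fin.lastCases ?_ (fun j => ?_) j
      · simp
      · simp [hrL j]
    · rw [← Fin.castSucc_zero, Fin.snoc_castSucc, h0]
    · rw [Fin.snoc_last]
    · rw [Fin.sum_univ_castSucc]
      simp only [Fin.snoc_castSucc, Fin.snoc_last, Fin.succ_castSucc, Fin.succ_last]
      rw [hsum, hlast, hcu, hc s hs]
      ring
  · obtain ⟨k, r, e, hr, hrL, h0, hlast, hsum⟩ := h s hs t ht
    exact ⟨k, r, e, hr, fun j => Finset.mem_insert_of_mem (hrL j), h0, hlast,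
      by rw [hsum, hc s hs, hc t ht]⟩

-- Equality would close a simple path from t to s in L, through u, into a cycle of distinct vertices
-- with translation sum zero, against genericity since i ≠ j.
variable {a} in
theorem IsGeneric.ne_of_isCluster (ha : IsGeneric a) {c : Fin n → ℝ} {L : Finset (Fin n)}
    (h : IsCluster a c L) {u s t : Fin n} (hu : u ∉ L) (hs : s ∈ L) (ht : t ∈ L) {i j : Fin ℓ}
    (hij : i ≠ j) : translation a i s u + translation a j u t ≠ c s - c t := by
  intro heq
  obtain ⟨k, r, e, hr, hrL, h0, hlast, hsum⟩ := h t ht s hs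
  have hinj : Function.Injective (Fin.cons u r : Fin (k + 2) → Fin n) := by
    rw [Fin.cons_injective_iff]
    refine ⟨?_, hr⟩
    rintro ⟨j, rfl⟩
    exact hu (hrL j)
  have hsub : ∀ m : Fin (k + 1), m.succ - 1 = m.castSucc := fun m => by
    rw [sub_eq_iff_eq_add, Fin.coeSucc_eq_succ]
  have hsub0 : (0 : Fin (k + 2)) - 1 = Fin.last (k + 1) := by
    rw [sub_eq_iff_eq_add, Fin.last_add_one]
  -- The cycle is u → t → … → s → u. Index 0 is the wrap-around edge s → u of colour i, index 1 the
  -- edge u → t of colour j.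
  have key := ha (k + 1) (Fin.cons i (Fin.cons j e)) (Fin.cons u r) hinj ?_ 0 (Fin.succ 0)
  · exact hij (by simpa using key)
  · rw [Fin.sum_univ_succ, Fin.sum_univ_succ, hsub0, ← Fin.succ_last]
    simp only [hsub, Fin.cons_zero, Fin.castSucc_zero, Fin.cons_succ, Fin.castSucc_succ]
    rw [hsum, h0, hlast]
    linarith

/-- No two tokens of the same colour in `T` coincide on a cluster of shape `c`. -/
def NonColliding (c : Fin n → ℝ) (T : Finset (Fin ℓ × Fin n)) : Prop :=
  ∀ i s t, (i, s) ∈ T → (i, t) ∈ T → s ≠ t → c s - c t ≠ translation a i s t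

/-- All tokens at the vertices in `U`. -/
abbrev allTokens (ℓ : ℕ) (U : Finset (Fin n)) : Finset (Fin ℓ × Fin n) :=
  Finset.univ ×ˢ U

theorem nonColliding_allTokens_singleton (c : Fin n → ℝ) (u : Fin n) :
    NonColliding a c (allTokens ℓ {u}) := by
  intro i s t hs ht hst
  rw [Finset.mem_product, Finset.mem_singleton] at hs ht
  exact absurd (hs.2.trans ht.2.symm) hst

-- A new token (j, u) colliding with an old (j, p) would, for j = i, make (i, s) collide with (i, p)
-- already before; for j ≠ i it contradicts genericity. The token (i, s) must be dropped, since it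
-- now coincides with (i, u).
variable {a} in
theorem NonColliding.union_allTokens (ha : IsGeneric a) {c : Fin n → ℝ} {L : Finset (Fin n)}
    (hL : IsCluster a c L) {T : Finset (Fin ℓ × Fin n)} (hTL : ∀ q ∈ T, q.2 ∈ L) {i : Fin ℓ}
    {s u : Fin n} (hs : s ∈ L) (hu : u ∉ L) (hT : NonColliding a c (insert (i, s) T))
    (his : (i, s) ∉ T) :
    NonColliding a (Function.update c u (c s - translation a i s u)) (T ∪ allTokens ℓ {u}) := by
  have hne : ∀ p ∈ L, p ≠ u := fun p hp h => hu (h ▸ hp)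
  have key : ∀ j p, (j, p) ∈ T → c s - c p ≠ translation a i s u + translation a j u p := by
    intro j p hp
    by_cases hij : i = j
    · subst hij
      have hsp : s ≠ p := fun h => his (h ▸ hp)
      have := hT i s p (Finset.mem_insert_self _ _) (Finset.mem_insert_of_mem hp) hsp
      rw [translation_eq] at this ⊢
      rw [translation_eq]
      intro h
      exact this (by linarith)
    · exact (ha.ne_of_isCluster hL hu hs (hTL _ hp) hij).symm
  intro j p q hp hq hpq
  simp only [Finset.mem_union, Finset.mem_product, Finset.mem_univ, Finset.mem_singleton,
    true_and] at hp hq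
  rcases hp with hp | rfl <;> rcases hq with hq | rfl
  · rw [Function.update_of_ne (hne _ (hTL _ hp)), Function.update_of_ne (hne _ (hTL _ hq))]
    exact hT j p q (Finset.mem_insert_of_mem hp) (Finset.mem_insert_of_mem hq) hpq
  · rw [Function.update_of_ne hpq, Function.update_self]
    intro h
    refine key j p hp ?_
    rw [translation_eq a j] at h ⊢
    linarith
  · rw [Function.update_of_ne hpq.symm, Function.update_self]
    intro h
    exact key j q hq (by linarith)
  · exact absurd rfl hpq

end MultiBraid

/-! ### Evaluation of the Whitney sum and the characteristic polynomial. -/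

namespace MultiBraid

open HyperplaneArrangement

variable {ℓ n : ℕ} (a : Matrix (Fin ℓ) (Fin (n - 1)) ℝ)

theorem allTokens_eq_union {U : Finset (Fin n)} {u : Fin n} (hu : u ∈ U) :
    allTokens ℓ U = allTokens ℓ {u} ∪ allTokens ℓ (U.erase u) := by
  rw [allTokens, allTokens, allTokens, ← Finset.product_union, ← Finset.insert_eq,
    Finset.insert_erase hu]

/-- Without active tokens, the vertices outside `U` move freely; fixing their position relative
to `u ∈ U` lowers every dimension by one. -/
theorem whitneySum_rigidSubspace_allTokens (c : Fin n → ℝ) {U : Finset (Fin n)} {u v : Fin n}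
    (hu : u ∈ U) (hv : v ∉ U) (d : ℝ) :
    whitneySum (rigidSubspace c U) (tokenFinset a (allTokens ℓ U)) =
      Polynomial.X * whitneySum (rigidSubspace c U ⊓ braidHyperplane v u d)
        (tokenFinset a (allTokens ℓ U)) := by
  rw [whitneySum, whitneySum, Finset.mul_sum]
  refine Finset.sum_congr rfl fun B hB => ?_
  rw [Finset.mem_powerset] at hB
  -- Shifts U as a block against its complement, recentred to have sum zero. Every hyperplane
  -- present joins two vertices of U, so it is invariant under this shift.
  set z₀ : Fin n → ℝ := fun s => (U.card : ℝ) / n - if s ∈ U then 1 else 0 with hz₀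
  have hzsum : z₀ ∈ sumZero n := by
    change ∑ s, z₀ s = 0
    have hn : (n : ℝ) ≠ 0 := by
      have := u.pos
      positivity
    rw [hz₀, Finset.sum_sub_distrib, Finset.sum_const, Finset.card_univ, Fintype.card_fin,
      nsmul_eq_mul, mul_div_cancel₀ _ hn, Finset.sum_ite_mem, Finset.univ_inter, Finset.sum_const,
      nsmul_eq_mul, mul_one, sub_self]
  let f : sumZero n →ₗ[ℝ] ℝ :=
    ((LinearMap.proj v : (Fin n → ℝ) →ₗ[ℝ] ℝ) - LinearMap.proj u) ∘ₗ (sumZero n).subtype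
  rw [flatWeight_eq_X_mul (F := rigidSubspace c U ⊓ B.inf id) (H := braidHyperplane v u d) f d
    (fun _ => Iff.rfl) ⟨z₀, hzsum⟩, inf_right_comm]
  · ring
  · change z₀ v - z₀ u = 1
    simp [hz₀, hu, hv]
  · intro x hx r
    rw [AffineSubspace.mem_inf_iff] at hx ⊢
    constructor
    · intro s hs t ht
      have := hx.1 s hs t ht
      simpa [hz₀, hs, ht] using this
    · have hmem : ∀ y : sumZero n, y ∈ B.inf id ↔ ∀ H ∈ B, y ∈ H := by
        intro y
        rw [Finset.inf_id_eq_sInf, AffineSubspace.mem_sInf_iff]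
        rfl
      rw [hmem]
      intro H hH
      have hxH := (hmem x).1 hx.2 H hH
      obtain ⟨i, s, t, hs, ht, -, rfl⟩ := (mem_tokenFinset a).1 (hB hH)
      rw [Finset.mem_product] at hs ht
      have : x.1 s - x.1 t = translation a i s t := hxH
      rw [mem_braidHyperplane]
      simpa [hz₀, hs.2, ht.2] using this

/-- Evaluation of the Whitney sum for a live cluster `L` with active tokens `T` and free
vertices `U`. -/
theorem whitneySum_eq_tokenPoly (hℓ : 1 ≤ ℓ) {a : Matrix (Fin ℓ) (Fin (n - 1)) ℝ}
    (ha : IsGeneric a) (m : ℕ) :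
    ∀ (U L : Finset (Fin n)) (c : Fin n → ℝ) (T : Finset (Fin ℓ × Fin n)), U.card = m →
      L.Nonempty → (∀ s ∈ L, s ∉ U) → IsCluster a c L → (∀ q ∈ T, q.2 ∈ L) →
      NonColliding a c T →
      whitneySum (rigidSubspace c U) (tokenFinset a (T ∪ allTokens ℓ U)) =
        tokenPoly ℓ T.card m := by
  classical
  induction m with
  | zero =>
    intro U L c T hU _ hLU _ hTL hT
    rw [Finset.card_eq_zero] at hU
    subst hU
    -- The rigid subspace is a single point, and non-collision says that no remaining hyperplane
    -- contains it.
    have h := whitneySum_union_of_le (rigidSubspace c ∅) ∅ (tokenFinset a T) ?_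
    · rw [Finset.empty_union] at h
      rw [allTokens, Finset.product_empty, Finset.union_empty, h, whitneySum_empty,
        flatWeight_rigidSubspace_empty, tokenPoly_zero_right]
    · intro e he
      obtain ⟨i, s, t, hs, ht, hst, rfl⟩ := (mem_tokenFinset a).1 he
      left
      rw [eq_bot_iff]
      rintro x ⟨h1, h2⟩
      exact hT i s t hs ht hst
        ((h1 s (Finset.notMem_empty s) t (Finset.notMem_empty t)).symm.trans h2)
  | succ m ihm =>
    intro U L c T hU hLne hLU hL hTL hT
    induction T using Finset.induction_on with
    | empty =>
      obtain ⟨v, hv⟩ := hLne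
      obtain ⟨u, hu⟩ : U.Nonempty := Finset.card_pos.1 (by omega)
      -- The old cluster stays rigid but carries no hyperplanes any more. Pinning u to it at the
      -- arbitrary offset 0 costs a factor y, and {u} becomes the new live cluster.
      rw [Finset.empty_union, whitneySum_rigidSubspace_allTokens a c hu (hLU v hv) 0,
        rigidSubspace_inf_braidHyperplane c (hLU v hv) hu, allTokens_eq_union hu,
        ihm _ {u} _ _ (by rw [Finset.card_erase_of_mem hu, hU, Nat.add_sub_cancel])
          (Finset.singleton_nonempty u) _ (isCluster_singleton a _ u) _
          (nonColliding_allTokens_singleton a _ u),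
        Finset.card_empty, tokenPoly_zero_succ hℓ]
      · simp [allTokens]
      · intro s hs
        rw [Finset.mem_singleton.1 hs]
        exact Finset.notMem_erase u U
      · intro q hq
        exact (Finset.mem_product.1 hq).2
    | insert q T hq ih =>
      obtain ⟨i, s⟩ := q
      have hs : s ∈ L := hTL (i, s) (Finset.mem_insert_self _ _)
      have hTL' : ∀ q ∈ T, q.2 ∈ L := fun q hq => hTL q (Finset.mem_insert_of_mem hq)
      have hT' : NonColliding a c T := fun j p r hp hr =>
        hT j p r (Finset.mem_insert_of_mem hp) (Finset.mem_insert_of_mem hr)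
      rw [Finset.insert_union, whitneySum_tokenFinset_insert, ih hTL' hT',
        Finset.card_insert_of_notMem hq, tokenPoly_succ_succ hℓ]
      congr 1
      -- Restriction attaches u to the cluster: its ℓ tokens become active and (i, s) is spent.
      have hterm : ∀ u ∈ U, whitneySum
          (rigidSubspace c U ⊓ braidHyperplane s u (translation a i s u))
          (tokenFinset a (T ∪ allTokens ℓ U)) = tokenPoly ℓ (T.card + ℓ) m := by
        intro u hu
        have huL : u ∉ L := fun h => hLU u h hu
        rw [rigidSubspace_inf_braidHyperplane c (hLU s hs) hu, allTokens_eq_union hu,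
          ← Finset.union_assoc,
          ihm _ (insert u L) _ _ (by rw [Finset.card_erase_of_mem hu, hU, Nat.add_sub_cancel])
            (Finset.insert_nonempty u L) _ _ _
            (NonColliding.union_allTokens ha hL hTL' hs huL hT hq),
          Finset.card_union_of_disjoint]
        · simp [allTokens]
        · rw [Finset.disjoint_left]
          intro q hq hq'
          rw [Finset.mem_product, Finset.mem_singleton] at hq'
          exact huL (hq'.2 ▸ hTL' q hq)
        · intro t ht
          rcases Finset.mem_insert.1 ht with rfl | ht
          · exact Finset.notMem_erase t U
          · exact fun h => hLU t ht (Finset.mem_of_mem_erase h)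
        · refine hL.insert huL hs i (fun t ht => ?_) (Function.update_self _ _ _)
          exact Function.update_of_ne (fun h : t = u => huL (h ▸ ht)) _ _
        · intro q hq
          rcases Finset.mem_union.1 hq with hq | hq
          · exact Finset.mem_insert_of_mem (hTL' q hq)
          · rw [Finset.mem_product, Finset.mem_singleton] at hq
            exact hq.2 ▸ Finset.mem_insert_self _ _
      -- Only free vertices contribute: a hyperplane towards another active token misses the rigid
      -- subspace by non-collision.
      have hsub : U ⊆ ({t | (i, t) ∈ T ∪ allTokens ℓ U ∧ t ≠ s} : Finset (Fin n)) := by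
        intro u hu
        simp only [Finset.mem_filter, Finset.mem_univ, true_and, Finset.mem_union,
          Finset.mem_product]
        exact ⟨Or.inr hu, fun h => hLU s hs (h ▸ hu)⟩
      rw [← Finset.sum_subset hsub, Finset.sum_congr rfl hterm, Finset.sum_const, hU,
        nsmul_eq_mul]
      · push_cast
        ring
      · intro t ht htU
        simp only [Finset.mem_filter, Finset.mem_univ, true_and, Finset.mem_union,
          Finset.mem_product] at ht
        have htT : (i, t) ∈ T := ht.1.resolve_right htU
        have hbot : rigidSubspace c U ⊓ braidHyperplane s t (translation a i s t) = ⊥ := by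
          rw [eq_bot_iff]
          rintro x ⟨h1, h2⟩
          exact hT i s t (Finset.mem_insert_self _ _) (Finset.mem_insert_of_mem htT) ht.2.symm
            ((h1 s (hLU s hs) t htU).symm.trans h2)
        rw [hbot, whitneySum_bot]

/-- One vertex alone is rigid for free, so the full arrangement is the state with a single live
vertex, its ℓ tokens active and n − 1 vertices free. -/
theorem map_charPoly_braidArrangement (hℓ : 1 ≤ ℓ) (hn : 1 ≤ n)
    {a : Matrix (Fin ℓ) (Fin (n - 1)) ℝ} (ha : IsGeneric a) :
    (braidArrangement a).charPoly.map (Int.castRingHom ℚ) = tokenPoly ℓ ℓ (n - 1) := by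
  set v : Fin n := ⟨0, hn⟩
  have hv : v ∈ (Finset.univ : Finset (Fin n)) := Finset.mem_univ v
  have h := whitneySum_eq_tokenPoly hℓ ha (n - 1) (Finset.univ.erase v) {v} 0 (allTokens ℓ {v})
    (by rw [Finset.card_erase_of_mem hv, Finset.card_univ, Fintype.card_fin])
    (Finset.singleton_nonempty v) (by simp) (isCluster_singleton a _ v)
    (fun q hq => (Finset.mem_product.1 hq).2) (nonColliding_allTokens_singleton a _ v)
  have htop : rigidSubspace (0 : Fin n → ℝ) (Finset.univ.erase v) = ⊤ := by
    rw [eq_top_iff]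
    intro x _ s hs t ht
    simp only [Finset.mem_erase, Finset.mem_univ, and_true, not_not] at hs ht
    rw [hs, ht, sub_self, sub_self]
  rw [map_charPoly, ← tokenFinset_univ, ← htop, ← Finset.univ_product_univ,
    ← allTokens, allTokens_eq_union hv, h]
  simp [allTokens]

end MultiBraid

/-- For `ℓ, n ≥ 1` and every generic matrix `a`, the characteristic polynomial of the `a`-braid
arrangement equals `((-1) ^ n n! / y) [z ^ n] exp (- ∑_{m ≥ 1} F_{ℓ,m} y z ^ m / m)`
(an identity of rational functions in `y`). -/
theorem mainTheorem3 (ℓ n : ℕ) (hℓ : 1 ≤ ℓ) (hn : 1 ≤ n)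
    (a : Matrix (Fin ℓ) (Fin (n - 1)) ℝ) (ha : MultiBraid.IsGeneric a) :
    algebraMap (Polynomial ℚ) (RatFunc ℚ)
        ((MultiBraid.braidArrangement a).charPoly.map (Int.castRingHom ℚ)) =
      (-1) ^ n * (n ! : RatFunc ℚ) / RatFunc.X *
        algebraMap (Polynomial ℚ) (RatFunc ℚ)
          (PowerSeries.coeff n
            ((PowerSeries.exp ℚ).subst (-MultiBraid.fussCatalanSeries ℓ))) := by
  -- P(0, n) = y P(ℓ, n−1) accounts for the division by y.
  have h1 := MultiBraid.tokenPoly_zero_succ hℓ (n - 1)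
  rw [Nat.sub_add_cancel hn, MultiBraid.tokenPoly_zero_left,
    ← MultiBraid.map_charPoly_braidArrangement hℓ hn ha, MultiBraid.expSeries] at h1
  have h2 := congrArg (algebraMap (Polynomial ℚ) (RatFunc ℚ)) h1
  simp only [map_mul, map_pow, map_neg, map_one, map_natCast, RatFunc.algebraMap_X] at h2
  rw [div_mul_eq_mul_div, h2, mul_div_cancel_left₀ _ RatFunc.X_ne_zero]
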